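/- Let $k$ be a commutative artinian ring, $\Lambda$ an Artin $k$-algebra (a $k$-algebra finitely generated as a $k$-module), and $\mathrm{mod}\,\Lambda$ the category of finitely generated right $\Lambda$-modules. Let $\mathcal X\subseteq\mathrm{mod}\,\Lambda$ be a strictly full subcategory that is resolving (it contains all finitely generated projective modules and is closed under finite direct sums, direct summands, extensions and kernels of epimorphisms) and contravariantly finite (for every $M\in\mathrm{mod}\,\Lambda$ there is a morphism $X\to M$ with $X\in\mathcal X$ through which every morphism $X'\to M$ with $X'\in\mathcal X$ factors). Let $\mathrm H(\Lambda)$ be the category of morphisms of $\mathrm{mod}\,\Lambda$ (a morphism from $f$ to $g$ being a commutative square), and let $\mathcal S_{\mathcal X}(\Lambda)$ be its full subcategory of monomorphisms $f:A\to B$ with $A$, $B$ and $\operatorname{Cok} f$ in $\mathcal X$. Let $\mathcal E^{\mathrm{scw}}_{\mathcal X}$ be the class of the sequences $$0\to (X_1\xrightarrow{f}X_2)\to (Z_1\xrightarrow{h}Z_2)\to (Y_1\xrightarrow{g}Y_2)\to 0$$ with terms in $\mathcal S_{\mathcal X}(\Lambda)$ that are short exact in $\mathrm H(\Lambda)$ and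 for which the three sequences $0\to X_i\to Z_i\to Y_i\to 0$ ($i=1,2$) and $0\to\operatorname{Cok} f\to\operatorname{Cok} h\to\operatorname{Cok} g\to 0$ all split. Write $\mathcal S^{\mathrm{scw}}_{\mathcal X}(\Lambda)$ for $\mathcal S_{\mathcal X}(\Lambda)$ with this class of short exact sequences. An admissible epimorphism is the second map of a sequence in the class; an object is projective if every morphism from it to the target of an admissible epimorphism factors through that epimorphism; and there are enough projectives if every object is the target of an admissible epimorphism with projective source. For a module $X\in\mathrm{mod}\,\Lambda$ let $\pi_X:P_X\to X$ be a projective cover, and let $\Omega_\Lambda(X)\hookrightarrow P_X$ be the inclusion of the kernel of $\pi_X$. Then an object $f$ of $\mathrm H(\Lambda)$ lies in $\mathcal S_{\mathcal X}(\Lambda)$ and is an indecomposable projective object of $\mathcal S^{\mathrm{scw}}_{\mathcal X}(\Lambda)$ if and only if it is isomorphic to one of the following objects: 1. $(X\xrightarrow{1}X)$ for some indecomposable $X\in\mathcal X$; 2. $(0\to X)$ for some indecomposable $X\in\mathcal X$; 3. $(\Omega_\Lambda(X)\hookrightarrow P_X)$ for some indecomposable $X\in\mathcal X$. Moreover, $\mathcal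 S^{\mathrm{scw}}_{\mathcal X}(\Lambda)$ has enough projectives. -/

import Mathlib

open CategoryTheory CategoryTheory.Limits
open scoped ZeroObject

universe u v

namespace MonoCat

section Exact

variable {C : Type u} [Category.{v} C] [Preadditive C]

/-- `X` is nonzero, and in every direct sum decomposition `X ≅ Y ⊕ Z` one of the two summands is
zero. Direct sums are given by bilimit bicones, so that no existence of biproducts is needed. -/
def IsIndecomposable (X : C) : Prop :=
  ¬ IsZero X ∧ ∀ (Y Z : C) (b : BinaryBicone Y Z), Nonempty b.IsBilimit → Nonempty (X ≅ b.pt) →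
    IsZero Y ∨ IsZero Z

/-- The admissible epimorphisms for a class `E` of short exact sequences. -/
def IsAdmissibleEpi (E : ObjectProperty (ShortComplex C)) {Y Z : C} (p : Y ⟶ Z) : Prop :=
  ∃ (X : C) (i : X ⟶ Y) (h : i ≫ p = 0), E (ShortComplex.mk i p h)

/-- The projective objects with respect to a class `E` of short exact sequences. -/
def IsProjectiveObj (E : ObjectProperty (ShortComplex C)) (P : C) : Prop :=
  ∀ ⦃Y Z : C⦄ (p : Y ⟶ Z), IsAdmissibleEpi E p → ∀ f : P ⟶ Z, ∃ g : P ⟶ Y, g ≫ p = f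

/-- Every object is the target of an admissible epimorphism with projective source. -/
def HasEnoughProjectives (E : ObjectProperty (ShortComplex C)) : Prop :=
  ∀ Z : C, ∃ (P : C) (p : P ⟶ Z), IsProjectiveObj E P ∧ IsAdmissibleEpi E p

end Exact

section Modules

variable {R : Type u} [Ring R]

/-- `π : P ⟶ M` is a projective cover: an essential epimorphism with projective source. -/
structure IsProjectiveCover {P M : ModuleCat.{v} R} (π : P ⟶ M) : Prop where
  projective : Projective P
  epi : Epi π
  essential : ∀ (Q : ModuleCat.{v} R) (g : Q ⟶ P), Epi (g ≫ π) → Epi g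

/-- Resolving subcategories (strictly full) of the category of finitely generated modules. -/
structure IsResolving (𝒳 : ObjectProperty (ModuleCat.{v} R)) : Prop where
  finite : ∀ M : ModuleCat.{v} R, 𝒳 M → Module.Finite R M
  of_iso : ∀ M N : ModuleCat.{v} R, Nonempty (M ≅ N) → 𝒳 M → 𝒳 N
  of_projective : ∀ P : ModuleCat.{v} R, Module.Finite R P → Module.Projective R P → 𝒳 P
  directSum : ∀ M N : ModuleCat.{v} R, 𝒳 M → 𝒳 N → 𝒳 (M ⊞ N)
  summand : ∀ M N : ModuleCat.{v} R, 𝒳 (M ⊞ N) → 𝒳 M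
  extension : ∀ S : ShortComplex (ModuleCat.{v} R), S.ShortExact → 𝒳 S.X₁ → 𝒳 S.X₃ → 𝒳 S.X₂
  kernel : ∀ S : ShortComplex (ModuleCat.{v} R), S.ShortExact → 𝒳 S.X₂ → 𝒳 S.X₃ → 𝒳 S.X₁

/-- Every finitely generated module has a right `𝒳`-approximation. -/
def IsContravariantlyFinite (𝒳 : ObjectProperty (ModuleCat.{v} R)) : Prop :=
  ∀ M : ModuleCat.{v} R, Module.Finite R M →
    ∃ (X : ModuleCat.{v} R) (f : X ⟶ M), 𝒳 X ∧
      ∀ (X' : ModuleCat.{v} R) (g : X' ⟶ M), 𝒳 X' → ∃ h : X' ⟶ X, h ≫ f = g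

/-- The objects of the monomorphism category of `𝒳`, inside the category of morphisms of modules:
the monomorphisms whose source, target and cokernel lie in `𝒳`. -/
def monoIn (𝒳 : ObjectProperty (ModuleCat.{v} R)) : ObjectProperty (Arrow (ModuleCat.{v} R)) :=
  fun f => Mono f.hom ∧ 𝒳 f.left ∧ 𝒳 f.right ∧ 𝒳 (cokernel f.hom)

variable {𝒳 : ObjectProperty (ModuleCat.{v} R)}

/-- The row of sources of a sequence of monomorphisms. -/
def leftRow (S : ShortComplex (monoIn 𝒳).FullSubcategory) : ShortComplex (ModuleCat.{v} R) :=
  ShortComplex.mk S.f.hom.left S.g.hom.left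
    (congrArg (fun t => CommaMorphism.left (InducedCategory.Hom.hom t)) S.zero)

/-- The row of targets of a sequence of monomorphisms. -/
def rightRow (S : ShortComplex (monoIn 𝒳).FullSubcategory) : ShortComplex (ModuleCat.{v} R) :=
  ShortComplex.mk S.f.hom.right S.g.hom.right
    (congrArg (fun t => CommaMorphism.right (InducedCategory.Hom.hom t)) S.zero)

/-- The row of cokernels of a sequence of monomorphisms, with the induced maps. -/
noncomputable def cokernelRow (S : ShortComplex (monoIn 𝒳).FullSubcategory) :
    ShortComplex (ModuleCat.{v} R) :=
  ShortComplex.mk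
    (cokernel.map S.X₁.obj.hom S.X₂.obj.hom S.f.hom.left S.f.hom.right S.f.hom.w.symm)
    (cokernel.map S.X₂.obj.hom S.X₃.obj.hom S.g.hom.left S.g.hom.right S.g.hom.w.symm)
    (by
      have h : S.f.hom.right ≫ S.g.hom.right = 0 := (rightRow S).zero
      rw [← cancel_epi (cokernel.π S.X₁.obj.hom)]
      simp [reassoc_of% h])

/-- The canonical class of short exact sequences of the monomorphism category: exactness in the
category of morphisms of modules is exactness of the row of sources and of the row of targets. -/
def canonicalExact (𝒳 : ObjectProperty (ModuleCat.{v} R)) :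
    ObjectProperty (ShortComplex (monoIn 𝒳).FullSubcategory) :=
  fun S => (leftRow S).ShortExact ∧ (rightRow S).ShortExact

/-- The class `scw`: the short exact sequences in the canonical class for which the rows of
sources, of targets and of cokernels all split. -/
def scwExact (𝒳 : ObjectProperty (ModuleCat.{v} R)) :
    ObjectProperty (ShortComplex (monoIn 𝒳).FullSubcategory) :=
  fun S => canonicalExact 𝒳 S ∧ Nonempty (leftRow S).Splitting ∧
    Nonempty (rightRow S).Splitting ∧ Nonempty (cokernelRow S).Splitting

end Modules

end MonoCat

namespace MonoCat

/-! A morphism of `monoIn 𝒳` is an admissible epimorphism exactly when it is a split epimorphism on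
sources, on targets and on cokernels: the kernel stays in `monoIn 𝒳` because `𝒳` is closed under
kernels of epimorphisms (`IsResolving.isAdmissibleEpi`). Each type of object in the list lifts along
one of these splittings. Maps from `X = X` are maps into the source, and maps from `0 → X` are maps
into the target. If `g` has projective target, maps out of `g` surject onto maps of cokernels, with
ambiguity a map from the target of `g` to a source (`isProjectiveObj_of_projective_right`).

Conversely, any `Z` is covered by the sum of `Z₁ = Z₁`, `0 → Z₂` and the kernel inclusion of a
projective `P ↠ Cok Z`; each summand splits one of the three rows. This gives enough projectives. An
indecomposable projective is a retract of such a sum, and by Fitting's lemma its endomorphisms are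
units or nilpotent, so it is a retract of one summand (`IsResolving.trichotomy`). In the third case
the same dichotomy shows that the cokernel is indecomposable and that the projection onto it is a
projective cover. -/

lemma eq_id_of_isIso_of_idem {C : Type u} [Category.{v} C] {X : C} {e : X ⟶ X} [IsIso e]
    (h : e ≫ e = e) : e = 𝟙 X := by
  rw [← cancel_epi e, h, Category.comp_id]

/-! ### Indecomposability through idempotents, and relative projectives -/

section Exact

variable {C : Type u} [Category.{v} C] [Preadditive C]

/-- `X` is nonzero and its only idempotent endomorphisms are `0` and `𝟙 X`. -/
def HasTrivialIdempotents (X : C) : Prop :=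
  𝟙 X ≠ 0 ∧ ∀ e : X ⟶ X, e ≫ e = e → e = 0 ∨ e = 𝟙 X

lemma HasTrivialIdempotents.of_iso {X Y : C} (i : X ≅ Y) (h : HasTrivialIdempotents X) :
    HasTrivialIdempotents Y := by
  refine ⟨fun h0 => h.1 ?_, fun e he => ?_⟩
  · rw [← i.hom_inv_id, ← Category.id_comp i.inv, h0]; simp
  · have hc : e = i.inv ≫ (i.hom ≫ e ≫ i.inv) ≫ i.hom := by simp
    rcases h.2 (i.hom ≫ e ≫ i.inv) (by simp [reassoc_of% he]) with h1 | h1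
    · left; rw [hc, h1]; simp
    · right; rw [hc, h1]; simp

/-- Splitting `e` and `𝟙 X - e` turns an idempotent into a direct sum decomposition; conversely,
projecting onto one summand is an idempotent. The idempotent form is the one that passes easily
between a full subcategory and its ambient category. -/
lemma isIndecomposable_iff [IsIdempotentComplete C] (X : C) :
    IsIndecomposable X ↔ HasTrivialIdempotents X := by
  refine and_congr (not_congr (IsZero.iff_id_eq_zero X)) ⟨fun h e he => ?_, ?_⟩
  · obtain ⟨Y, i, r, hir, hri⟩ := IsIdempotentComplete.idempotents_split X e he
    obtain ⟨Z, j, s, hjs, hsj⟩ := IsIdempotentComplete.idempotents_split X (𝟙 X - e)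
      (by simp [he])
    have hie : i ≫ e = i := by rw [← hri, reassoc_of% hir]
    have her : e ≫ r = r := by rw [← hri, Category.assoc, hir, Category.comp_id]
    have his : i ≫ s = 0 := by
      have : i ≫ s ≫ j ≫ s = 0 := by
        rw [reassoc_of% hsj, Preadditive.sub_comp, Preadditive.comp_sub, reassoc_of% hie]; simp
      simpa [hjs] using this
    have hjr : j ≫ r = 0 := by
      have : (j ≫ s) ≫ j ≫ r = 0 := by
        rw [Category.assoc, reassoc_of% hsj, Preadditive.sub_comp, her]; simp
      simpa [hjs] using this
    let b : BinaryBicone Y Z :=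
      { pt := X, fst := r, snd := s, inl := i, inr := j,
        inl_fst := hir, inl_snd := his, inr_fst := hjr, inr_snd := hjs }
    rcases h Y Z b ⟨isBinaryBilimitOfTotal b (by simp [b, hri, hsj])⟩ ⟨Iso.refl _⟩ with h0 | h0
    · left; rw [← hri, h0.eq_of_tgt r 0, zero_comp]
    · right
      have : 𝟙 X - e = 0 := by rw [← hsj, h0.eq_of_tgt s 0, zero_comp]
      exact (sub_eq_zero.1 this).symm
  · rintro h Y Z b - ⟨i⟩
    rcases h (i.hom ≫ (b.fst ≫ b.inl) ≫ i.inv) (by simp) with h0 | h0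
    · left
      rw [IsZero.iff_id_eq_zero]
      have : b.inl ≫ i.inv ≫ (i.hom ≫ (b.fst ≫ b.inl) ≫ i.inv) ≫ i.hom ≫ b.fst = 0 := by
        rw [h0]; simp
      simpa using this
    · right
      rw [IsZero.iff_id_eq_zero]
      have : b.inr ≫ i.inv ≫ (i.hom ≫ (b.fst ≫ b.inl) ≫ i.inv) ≫ i.hom ≫ b.snd = 𝟙 Z := by
        rw [h0]; simp
      simpa using this.symm

lemma IsProjectiveObj.of_iso {E : ObjectProperty (ShortComplex C)} {X Y : C} (i : X ≅ Y)
    (h : IsProjectiveObj E X) : IsProjectiveObj E Y := fun _ _ p hp f => by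
  obtain ⟨g, hg⟩ := h p hp (i.hom ≫ f)
  exact ⟨i.inv ≫ g, by simp [hg]⟩

/-- An object whose identity is a sum of two endomorphisms that factor through projective objects
is projective. -/
lemma IsProjectiveObj.of_sum {E : ObjectProperty (ShortComplex C)} {T X Y : C}
    (hX : IsProjectiveObj E X) (hY : IsProjectiveObj E Y) {a : T ⟶ X} {a' : X ⟶ T}
    {b : T ⟶ Y} {b' : Y ⟶ T} (h : a ≫ a' + b ≫ b' = 𝟙 T) : IsProjectiveObj E T :=
  fun _ _ p hp f => by
    obtain ⟨g₁, h₁⟩ := hX p hp (a' ≫ f)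
    obtain ⟨g₂, h₂⟩ := hY p hp (b' ≫ f)
    refine ⟨a ≫ g₁ + b ≫ g₂, ?_⟩
    rw [Preadditive.add_comp, Category.assoc, Category.assoc, h₁, h₂, ← Category.assoc,
      ← Category.assoc, ← Preadditive.add_comp, h, Category.id_comp]

/-- In a ring whose elements are units or nilpotent, one of two elements with sum `1` is a unit. -/
lemma isUnit_or_isUnit_of_add_eq_one {A : Type*} [Ring A]
    (h : ∀ a : A, IsUnit a ∨ IsNilpotent a) {a b : A} (hab : a + b = 1) :
    IsUnit a ∨ IsUnit b := by
  rcases h a with ha | ha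
  · exact Or.inl ha
  · right
    rw [eq_sub_of_add_eq' hab]
    exact ha.isUnit_one_sub

end Exact

/-! ### Idempotents in full subcategories and in arrow categories -/

instance isIdempotentComplete_fullSubcategory {C : Type u} [Category.{v} C]
    [IsIdempotentComplete C] (P : ObjectProperty C) [P.IsStableUnderRetracts] :
    IsIdempotentComplete P.FullSubcategory where
  idempotents_split X p hp := by
    obtain ⟨Y, i, r, h1, h2⟩ := IsIdempotentComplete.idempotents_split X.obj p.hom
      (congrArg InducedCategory.Hom.hom hp)
    have hY : P Y := P.prop_of_retract ⟨i, r, h1⟩ X.property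
    refine ⟨⟨Y, hY⟩, ObjectProperty.homMk i, ObjectProperty.homMk r, ?_, ?_⟩
    · ext; exact h1
    · ext; exact h2

instance isIdempotentComplete_arrow {C : Type u} [Category.{v} C]
    [HasEqualizers C] : IsIdempotentComplete (Arrow C) :=
  (Idempotents.isIdempotentComplete_iff_hasEqualizer_of_id_and_idempotent _).2
    fun _ _ _ => inferInstance

instance isIdempotentComplete_of_hasEqualizers {C : Type u} [Category.{v} C] [HasEqualizers C] :
    IsIdempotentComplete C :=
  (Idempotents.isIdempotentComplete_iff_hasEqualizer_of_id_and_idempotent _).2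
    fun _ _ _ => inferInstance

lemma hasTrivialIdempotents_fullSubcategory_iff {C : Type u} [Category.{v} C] [Preadditive C]
    (P : ObjectProperty C) (X : P.FullSubcategory) :
    HasTrivialIdempotents X ↔ HasTrivialIdempotents X.obj := by
  refine and_congr (not_congr ⟨fun h => congrArg InducedCategory.Hom.hom h, fun h => ?_⟩)
    ⟨fun h e he => ?_, fun h e he => ?_⟩
  · ext; exact h
  · rcases h (ObjectProperty.homMk e) (by ext; exact he) with h | h
    · exact Or.inl (congrArg InducedCategory.Hom.hom h)
    · exact Or.inr (congrArg InducedCategory.Hom.hom h)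
  · rcases h e.hom (congrArg InducedCategory.Hom.hom he) with h | h
    · left; ext; exact h
    · right; ext; exact h

lemma arrow_hom_ext {A : Type u} [Category.{v} A] {f g : Arrow A} [Mono g.hom] {a b : f ⟶ g}
    (h : a.right = b.right) : a = b := by
  ext
  · rw [← cancel_mono g.hom, Arrow.w a, Arrow.w b, h]
  · exact h

/-- A morphism of arrows given by a map from the target to the source. -/
def arrowHomOfRight {A : Type u} [Category.{v} A] {g f : Arrow A} (s : g.right ⟶ f.left) : g ⟶ f :=
  Arrow.homMk (g.hom ≫ s) (s ≫ f.hom) (by simp)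

@[simp]
lemma arrowHomOfRight_right {A : Type u} [Category.{v} A] {g f : Arrow A} (s : g.right ⟶ f.left) :
    (arrowHomOfRight s).right = s ≫ f.hom := rfl

/-! ### Monomorphisms and their cokernels in an abelian category -/

section Abelian

variable {A : Type u} [Category.{v} A] [Abelian A]

lemma exists_fac_of_comp_cokernel_π_eq_zero {X Y W : A} (f : X ⟶ Y) [Mono f] (k : W ⟶ Y)
    (hk : k ≫ cokernel.π f = 0) : ∃ l : W ⟶ X, l ≫ f = k :=
  ⟨(ShortComplex.exact_cokernel f).lift k hk, (ShortComplex.exact_cokernel f).lift_f k hk⟩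

@[simp]
lemma arrow_zero_right (f g : Arrow A) : (0 : f ⟶ g).right = 0 := rfl

@[simp]
lemma arrow_sub_right {f g : Arrow A} (a b : f ⟶ g) : (a - b).right = a.right - b.right := rfl

@[simp]
lemma arrow_add_right {f g : Arrow A} (a b : f ⟶ g) : (a + b).right = a.right + b.right := rfl

instance mono_mk_hom {X Y : A} (f : X ⟶ Y) [Mono f] : Mono (Arrow.mk f).hom := ‹Mono f›

/-- The map induced on cokernels by a morphism of arrows. -/
noncomputable def cokMap {f g : Arrow A} (m : f ⟶ g) : cokernel f.hom ⟶ cokernel g.hom :=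
  cokernel.map f.hom g.hom m.left m.right m.w.symm

@[simp]
lemma π_cokMap {f g : Arrow A} (m : f ⟶ g) :
    cokernel.π f.hom ≫ cokMap m = m.right ≫ cokernel.π g.hom := by
  simp [cokMap]

lemma cokMap_id (f : Arrow A) : cokMap (𝟙 f) = 𝟙 (cokernel f.hom) := by
  rw [← cancel_epi (cokernel.π f.hom)]; simp

lemma cokMap_comp {f g h : Arrow A} (m : f ⟶ g) (n : g ⟶ h) :
    cokMap (m ≫ n) = cokMap m ≫ cokMap n := by
  rw [← cancel_epi (cokernel.π f.hom)]
  rw [π_cokMap, ← Category.assoc, π_cokMap, Category.assoc, π_cokMap, Arrow.comp_right,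
    Category.assoc]

lemma cokMap_zero (f g : Arrow A) : cokMap (0 : f ⟶ g) = 0 := by
  rw [← cancel_epi (cokernel.π f.hom)]; simp

lemma cokMap_add {f g : Arrow A} (m n : f ⟶ g) : cokMap (m + n) = cokMap m + cokMap n := by
  rw [← cancel_epi (cokernel.π f.hom)]; simp [Preadditive.add_comp, Preadditive.comp_add]

lemma cokMap_sub {f g : Arrow A} (m n : f ⟶ g) : cokMap (m - n) = cokMap m - cokMap n := by
  rw [← cancel_epi (cokernel.π f.hom)]; simp [Preadditive.sub_comp, Preadditive.comp_sub]

/-- The action of endomorphisms of an arrow on its cokernel. -/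
noncomputable def cokMapEnd (f : Arrow A) : End f →* End (cokernel f.hom) where
  toFun e := cokMap e
  map_one' := cokMap_id f
  map_mul' a b := cokMap_comp b a

/-- Morphisms between cokernels lift to morphisms of monomorphisms when the target of the first
one is projective. -/
lemma exists_cokMap_eq {g f : Arrow A} [Projective g.right] [Mono f.hom]
    (φ : cokernel g.hom ⟶ cokernel f.hom) : ∃ m : g ⟶ f, cokMap m = φ := by
  let β : g.right ⟶ f.right := Projective.factorThru (cokernel.π g.hom ≫ φ) (cokernel.π f.hom)
  have hβ : β ≫ cokernel.π f.hom = cokernel.π g.hom ≫ φ := Projective.factorThru_comp _ _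
  -- The monomorphism `f.hom` is the kernel of its cokernel, so `β` restricts to the sources.
  obtain ⟨α, hα⟩ := exists_fac_of_comp_cokernel_π_eq_zero f.hom (g.hom ≫ β)
    (by rw [Category.assoc, hβ, cokernel.condition_assoc, zero_comp])
  refine ⟨Arrow.homMk α β hα, ?_⟩
  rw [← cancel_epi (cokernel.π g.hom), ← hβ]
  simp

/-- Complements `exists_cokMap_eq`: it measures how far a lift of a map of cokernels is from being
unique. -/
lemma exists_right_eq_of_cokMap_eq_zero {g f : Arrow A} [Mono f.hom] {m : g ⟶ f}
    (hm : cokMap m = 0) : ∃ s : g.right ⟶ f.left, s ≫ f.hom = m.right := by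
  apply exists_fac_of_comp_cokernel_π_eq_zero
  rw [← π_cokMap, hm, comp_zero]

/-- A monomorphism is the kernel of its cokernel. -/
lemma nonempty_arrow_iso_kernel_ι (f : Arrow A) [Mono f.hom] :
    Nonempty (f ≅ Arrow.mk (kernel.ι (cokernel.π f.hom))) := by
  obtain ⟨l, hl⟩ := exists_fac_of_comp_cokernel_π_eq_zero f.hom (kernel.ι (cokernel.π f.hom))
    (kernel.condition _)
  refine ⟨Arrow.isoMk ⟨kernel.lift _ f.hom (cokernel.condition _), l, ?_, ?_⟩ (Iso.refl _) ?_⟩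
  · rw [← cancel_mono f.hom]; simp [hl]
  · rw [← cancel_mono (kernel.ι (cokernel.π f.hom))]; simp [hl]
  · simp

lemma hasTrivialIdempotents_mk_id_iff (X : A) :
    HasTrivialIdempotents (Arrow.mk (𝟙 X)) ↔ HasTrivialIdempotents X := by
  refine and_congr (not_congr ⟨fun h => congrArg CommaMorphism.right h, fun h => ?_⟩)
    ⟨fun h e he => ?_, fun h e he => ?_⟩
  · exact arrow_hom_ext (f := Arrow.mk (𝟙 X)) (g := Arrow.mk (𝟙 X)) h
  · rcases h (Arrow.homMk e e (by simp)) (by ext <;> exact he) with h | h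
    · exact Or.inl (congrArg CommaMorphism.right h)
    · exact Or.inr (congrArg CommaMorphism.right h)
  · rcases h e.right (congrArg CommaMorphism.right he) with h | h
    · left; exact arrow_hom_ext (f := Arrow.mk (𝟙 X)) (g := Arrow.mk (𝟙 X)) h
    · right; exact arrow_hom_ext (f := Arrow.mk (𝟙 X)) (g := Arrow.mk (𝟙 X)) h

instance mono_zero_from_zero (X : A) : Mono (0 : (0 : A) ⟶ X) :=
  ⟨fun _ _ _ => (isZero_zero A).eq_of_tgt _ _⟩

lemma hasTrivialIdempotents_mk_zero_iff (X : A) :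
    HasTrivialIdempotents (Arrow.mk (0 : (0 : A) ⟶ X)) ↔ HasTrivialIdempotents X := by
  refine and_congr (not_congr ⟨fun h => congrArg CommaMorphism.right h, fun h => ?_⟩)
    ⟨fun h e he => ?_, fun h e he => ?_⟩
  · exact arrow_hom_ext h
  · rcases h (Arrow.homMk 0 e (by simp)) (arrow_hom_ext he) with h | h
    · exact Or.inl (congrArg CommaMorphism.right h)
    · exact Or.inr (congrArg CommaMorphism.right h)
  · rcases h e.right (congrArg CommaMorphism.right he) with h | h
    · left; exact arrow_hom_ext h
    · right; exact arrow_hom_ext h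

/-- The kernel inclusion of an essential epimorphism inherits trivial idempotents from the target
of the epimorphism. -/
lemma HasTrivialIdempotents.mk_kernel_ι {P X : A} (π : P ⟶ X) [Epi π]
    (hess : ∀ (Q : A) (g : Q ⟶ P), Epi (g ≫ π) → Epi g) (h : HasTrivialIdempotents X) :
    HasTrivialIdempotents (Arrow.mk (kernel.ι π)) := by
  -- Since `𝟙 P - r` does not change `π`, it is epi by essentiality; an epi idempotent is the
  -- identity.
  have epi_eq_zero : ∀ r : P ⟶ P, r ≫ r = r → r ≫ π = 0 → r = 0 := by
    intro r hr h0
    have : Epi (𝟙 P - r) := hess _ _ (by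
      rw [Preadditive.sub_comp, Category.id_comp, h0, sub_zero]; infer_instance)
    have h2 : 𝟙 P - r = 𝟙 P := by
      rw [← cancel_epi (𝟙 P - r)]
      simp [hr]
    simpa using h2
  have key : ∀ e : Arrow.mk (kernel.ι π) ⟶ Arrow.mk (kernel.ι π), e ≫ e = e →
      e.right ≫ π = 0 → e = 0 := fun e he h0 =>
    arrow_hom_ext (epi_eq_zero e.right (congrArg CommaMorphism.right he) h0)
  refine ⟨fun h0 => h.1 ?_, fun e he => ?_⟩
  · have hP : 𝟙 P = 0 := congrArg CommaMorphism.right h0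
    rw [← cancel_epi π, Category.comp_id, comp_zero, ← Category.id_comp π, hP, zero_comp]
  · have hw : kernel.ι π ≫ e.right = e.left ≫ kernel.ι π := (Arrow.w e).symm
    have hr : e.right ≫ e.right = e.right := congrArg CommaMorphism.right he
    -- The target component of `e` preserves the kernel of `π`, so it induces an idempotent `ε` of
    -- `X`. If `ε` is `0`, then `key` kills `e`; if it is `𝟙 X`, then `key` kills `𝟙 - e`.
    let ε : X ⟶ X := (Abelian.epiIsCokernelOfKernel _ (kernelIsKernel π)).desc
      (CokernelCofork.ofπ (e.right ≫ π) (by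
        change kernel.ι π ≫ e.right ≫ π = 0
        rw [reassoc_of% hw, kernel.condition, comp_zero]))
    have hε : π ≫ ε = e.right ≫ π :=
      (Abelian.epiIsCokernelOfKernel _ (kernelIsKernel π)).fac _ WalkingParallelPair.one
    have hidem : ε ≫ ε = ε := by
      rw [← cancel_epi π, reassoc_of% hε, hε]
      exact (reassoc_of% hr) π
    rcases h.2 ε hidem with h0 | h1
    · left
      exact key e he (by rw [← hε, h0, comp_zero])
    · right
      have : 𝟙 _ - e = 0 := key _ (by simp [he]) (by
        rw [h1, Category.comp_id] at hε
        have h2 : ∀ r : P ⟶ P, π = r ≫ π → (𝟙 P - r) ≫ π = 0 := fun r hr => by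
          rw [Preadditive.sub_comp, ← hr, Category.id_comp, sub_self]
        exact h2 e.right hε)
      exact (sub_eq_zero.1 this).symm

lemma coker_id_ne_zero {f : Arrow A} [Mono f.hom] (hiso : ¬ IsIso f.hom) :
    𝟙 (cokernel f.hom) ≠ 0 := fun h => hiso <| by
  have : Epi f.hom := Preadditive.epi_of_cokernel_zero (by
    rw [← Category.comp_id (cokernel.π f.hom)]
    exact (congrArg (cokernel.π f.hom ≫ ·) h).trans comp_zero)
  exact isIso_of_mono_of_epi f.hom

section

variable {f : Arrow A} [Mono f.hom] [Projective f.right]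
  (hf : ∀ e : End f, IsUnit e ∨ IsNilpotent e)
  (hiso : ¬ IsIso f.hom)

include hf

/-- Endomorphisms of the cokernel lift to `f` because `f.right` is projective, and both units and
nilpotents are preserved by `cokMapEnd`. -/
lemma coker_isUnit_or_isNilpotent (ε : End (cokernel f.hom)) : IsUnit ε ∨ IsNilpotent ε := by
  obtain ⟨e, he⟩ := exists_cokMap_eq ε
  have he' : cokMapEnd f e = ε := he
  rcases hf e with h | ⟨n, hn⟩
  · left; rw [← he']; exact h.map _
  · right; exact ⟨n, by rw [← he', ← map_pow, hn]; exact cokMap_zero _ _⟩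

include hiso

lemma hasTrivialIdempotents_coker : HasTrivialIdempotents (cokernel f.hom) := by
  refine ⟨coker_id_ne_zero hiso, fun (ε : End (cokernel f.hom)) hε => ?_⟩
  rcases coker_isUnit_or_isNilpotent hf ε with h | ⟨n, hn⟩
  · right
    have := (isUnit_iff_isIso ε).1 h
    exact eq_id_of_isIso_of_idem hε
  · left
    have h1 : IsIdempotentElem (M := End (cokernel f.hom)) ε := hε
    rw [← h1.pow_succ_eq n]
    rw [pow_succ, hn, zero_mul]

/-- Lifting the projection through `g` yields an endomorphism of `f` that factors through `g` on
targets and is the identity on the nonzero cokernel. It cannot be nilpotent, so it is a unit and `g`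
is epi. -/
lemma epi_of_epi_comp_cokernel_π (Q : A) (g : Q ⟶ f.right) (hg : Epi (g ≫ cokernel.π f.hom)) :
    Epi g := by
  let β : f.right ⟶ Q := Projective.factorThru (cokernel.π f.hom) (g ≫ cokernel.π f.hom)
  have hβ : β ≫ g ≫ cokernel.π f.hom = cokernel.π f.hom := Projective.factorThru_comp _ _
  obtain ⟨α, hα⟩ := exists_fac_of_comp_cokernel_π_eq_zero f.hom (f.hom ≫ β ≫ g)
    (by simp [hβ])
  let e : End f := Arrow.homMk α (β ≫ g) hα
  have he : cokMapEnd f e = 1 := by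
    change cokMap e = 𝟙 _
    rw [← cancel_epi (cokernel.π f.hom)]
    simpa [e] using hβ
  rcases hf e with h | ⟨n, hn⟩
  · have : IsIso e := (isUnit_iff_isIso e).1 h
    have : IsIso e.right := inferInstance
    have : Epi (β ≫ g) := (inferInstance : Epi e.right)
    exact epi_of_epi β g
  · exfalso
    apply coker_id_ne_zero hiso
    have h1 := congrArg (cokMapEnd f) hn
    rw [map_pow, he, one_pow] at h1
    exact h1.trans (cokMap_zero _ _)

end

end Abelian

/-! ### Fitting's lemma for arrows of finite length -/

section Fitting

variable {R : Type u} [Ring R]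

lemma end_pow_left {f : Arrow (ModuleCat.{v} R)} (e : End f) (n : ℕ) :
    (CommaMorphism.left (e ^ n) : f.left ⟶ f.left).hom =
      ((CommaMorphism.left e : f.left ⟶ f.left).hom : Module.End R f.left) ^ n := by
  induction n with
  | zero => rfl
  | succ n ih => rw [pow_succ', pow_succ', ← ih]; rfl

lemma end_pow_right {f : Arrow (ModuleCat.{v} R)} (e : End f) (n : ℕ) :
    (CommaMorphism.right (e ^ n) : f.right ⟶ f.right).hom =
      ((CommaMorphism.right e : f.right ⟶ f.right).hom : Module.End R f.right) ^ n := by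
  induction n with
  | zero => rfl
  | succ n ih => rw [pow_succ', pow_succ', ← ih]; rfl

open Submodule in
/-- A linear map intertwining two endomorphisms with a Fitting decomposition commutes with the
Fitting projections. -/
lemma map_projection_range {M N : Type*} [AddCommGroup M] [Module R M] [AddCommGroup N]
    [Module R N] (φ : Module.End R M) (ψ : Module.End R N) (f : M →ₗ[R] N)
    (hf : ∀ x, f (φ x) = ψ (f x)) (hφ : IsCompl (LinearMap.range φ) (LinearMap.ker φ))
    (hψ : IsCompl (LinearMap.range ψ) (LinearMap.ker ψ)) (x : M) :
    f (projection _ _ hφ x) = projection _ _ hψ (f x) := by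
  obtain ⟨y, hy, z, hz, rfl⟩ := Submodule.mem_sup.1
    (hφ.sup_eq_top ▸ Submodule.mem_top : x ∈ LinearMap.range φ ⊔ LinearMap.ker φ)
  have hfy : f y ∈ LinearMap.range ψ := by
    obtain ⟨w, rfl⟩ := hy
    exact ⟨f w, (hf w).symm⟩
  have hfz : f z ∈ LinearMap.ker ψ := by
    rw [LinearMap.mem_ker, ← hf, LinearMap.mem_ker.1 hz, map_zero]
  rw [map_add, map_add, map_add, map_add, projection_apply_of_mem_left hφ hy,
    projection_apply_of_mem_right hφ hz, projection_apply_of_mem_left hψ hfy,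
    projection_apply_of_mem_right hψ hfz, map_zero]

lemma isUnit_of_ker_range {M : Type*} [AddCommGroup M] [Module R M] (φ : Module.End R M)
    (hφ : IsCompl (LinearMap.range φ) (LinearMap.ker φ))
    (h : Submodule.projection _ _ hφ = LinearMap.id) : IsUnit φ := by
  rw [Module.End.isUnit_iff]
  have hr : LinearMap.range φ = ⊤ := by
    rw [← Submodule.range_projection hφ, h, LinearMap.range_id]
  refine ⟨?_, LinearMap.range_eq_top.1 hr⟩
  rw [← LinearMap.ker_eq_bot]
  have := hφ.inf_eq_bot
  rwa [hr, top_inf_eq] at this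

lemma eq_zero_of_projection {M : Type*} [AddCommGroup M] [Module R M] (φ : Module.End R M)
    (hφ : IsCompl (LinearMap.range φ) (LinearMap.ker φ))
    (h : Submodule.projection _ _ hφ = 0) : φ = 0 := by
  rw [← LinearMap.range_eq_bot, ← Submodule.range_projection hφ, h, LinearMap.range_zero]

/-- Fitting's lemma for morphisms between modules of finite length. -/
lemma HasTrivialIdempotents.isUnit_or_isNilpotent {f : Arrow (ModuleCat.{v} R)}
    [IsNoetherian R f.left] [IsArtinian R f.left] [IsNoetherian R f.right] [IsArtinian R f.right]
    (h : HasTrivialIdempotents f) (e : End f) : IsUnit e ∨ IsNilpotent e := by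
  let φ : Module.End R f.left := (CommaMorphism.left e : f.left ⟶ f.left).hom
  let ψ : Module.End R f.right := (CommaMorphism.right e : f.right ⟶ f.right).hom
  -- One exponent must give the Fitting decomposition of source and target at once; `n ≥ 1` lets
  -- invertibility descend from the `n`-th powers to `φ` and `ψ`.
  obtain ⟨n, hφ', hψ', hn⟩ := (φ.eventually_isCompl_ker_pow_range_pow.and
    (ψ.eventually_isCompl_ker_pow_range_pow.and (Filter.eventually_ge_atTop 1))).exists
  have hφ := hφ'.symm
  have hψ := hψ'.symm
  have hcomm : ∀ x, f.hom.hom ((φ ^ n) x) = (ψ ^ n) (f.hom.hom x) := fun x => by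
    have := Arrow.w (e ^ n : End f)
    rw [← end_pow_left e n, ← end_pow_right e n]
    exact congrArg (fun t => ModuleCat.Hom.hom t x) this
  let p : f ⟶ f := Arrow.homMk (ModuleCat.ofHom (Submodule.projection _ _ hφ))
    (ModuleCat.ofHom (Submodule.projection _ _ hψ)) (by
      ext x
      exact map_projection_range _ _ f.hom.hom hcomm hφ hψ x)
  have hp : p ≫ p = p := by
    ext x
    · exact Submodule.projection_apply_of_mem_left hφ (Submodule.projection_apply_mem hφ x)
    · exact Submodule.projection_apply_of_mem_left hψ (Submodule.projection_apply_mem hψ x)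
  have hl : ∀ q : f ⟶ f, p = q → Submodule.projection _ _ hφ = q.left.hom := by
    rintro _ rfl; rfl
  have hr : ∀ q : f ⟶ f, p = q → Submodule.projection _ _ hψ = q.right.hom := by
    rintro _ rfl; rfl
  rcases h.2 p hp with h0 | h1
  · right
    refine ⟨n, ?_⟩
    have h2 : φ ^ n = 0 := eq_zero_of_projection _ hφ (hl _ h0)
    have h3 : ψ ^ n = 0 := eq_zero_of_projection _ hψ (hr _ h0)
    rw [← end_pow_left] at h2
    rw [← end_pow_right] at h3
    exact Arrow.hom_ext _ _ (ModuleCat.hom_ext h2) (ModuleCat.hom_ext h3)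
  · left
    have h2 : IsUnit φ := (isUnit_pow_iff (by omega)).1 (isUnit_of_ker_range _ hφ (hl _ h1))
    have h3 : IsUnit ψ := (isUnit_pow_iff (by omega)).1 (isUnit_of_ker_range _ hψ (hr _ h1))
    rw [Module.End.isUnit_iff] at h2 h3
    rw [isUnit_iff_isIso]
    have i1 : IsIso (CommaMorphism.left e : f.left ⟶ f.left) :=
      (ConcreteCategory.isIso_iff_bijective _).2 h2
    have i2 : IsIso (CommaMorphism.right e : f.right ⟶ f.right) :=
      (ConcreteCategory.isIso_iff_bijective _).2 h3
    exact Arrow.isIso_of_isIso_left_of_isIso_right (ff := (e : f ⟶ f))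

end Fitting

/-! ### Closure properties of the monomorphism category -/

section Resolving

variable {R : Type u} [Ring R] {𝒳 : ObjectProperty (ModuleCat.{v} R)}

lemma IsResolving.of_retract (h : IsResolving 𝒳) {X Y : ModuleCat.{v} R} (r : Retract X Y)
    (hY : 𝒳 Y) : 𝒳 X := by
  let S := ShortComplex.mk (kernel.ι r.r) r.r (kernel.condition _)
  have hS : S.Exact := ShortComplex.exact_kernel r.r
  let s : S.Splitting := ShortComplex.Splitting.ofExactOfSection S hS r.i r.retract
    (inferInstance : Mono (kernel.ι r.r))
  -- The splitting puts `X` second, while `summand` extracts the first term.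
  exact h.summand _ _ (h.of_iso _ _ ⟨s.isoBinaryBiproduct ≪≫ biprod.braiding _ _⟩ hY)

/-- The retract of cokernels induced by a retract of arrows. -/
noncomputable def cokRetract {f g : Arrow (ModuleCat.{v} R)} (r : Retract f g) :
    Retract (cokernel f.hom) (cokernel g.hom) where
  i := cokMap r.i
  r := cokMap r.r
  retract := by rw [← cokMap_comp, r.retract, cokMap_id]

lemma IsResolving.monoIn_of_retract (h : IsResolving 𝒳) {f g : Arrow (ModuleCat.{v} R)}
    (r : Retract f g) (hg : monoIn 𝒳 g) : monoIn 𝒳 f := by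
  obtain ⟨h1, h2, h3, h4⟩ := hg
  refine ⟨?_, h.of_retract (r.map Arrow.leftFunc) h2, h.of_retract (r.map Arrow.rightFunc) h3,
    h.of_retract (cokRetract r) h4⟩
  have hi : r.i.left ≫ r.r.left = 𝟙 _ := (r.map Arrow.leftFunc).retract
  have : Mono r.i.left := mono_of_mono_fac hi
  have : Mono (f.hom ≫ r.i.right) := by
    rw [← Arrow.w]; infer_instance
  exact mono_of_mono _ r.i.right

lemma IsResolving.isStableUnderRetracts_monoIn (h : IsResolving 𝒳) :
    (monoIn 𝒳).IsStableUnderRetracts where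
  of_retract := h.monoIn_of_retract

instance hasBinaryBiproducts_arrow : HasBinaryBiproducts (Arrow (ModuleCat.{v} R)) :=
  HasBinaryBiproducts.of_hasBinaryProducts

lemma IsResolving.prop_of_biprod_total (h : IsResolving 𝒳) {X Y Z : ModuleCat.{v} R} (hX : 𝒳 X)
    (hY : 𝒳 Y) {a : Z ⟶ X} {a' : X ⟶ Z} {b : Z ⟶ Y} {b' : Y ⟶ Z} (e : a ≫ a' + b ≫ b' = 𝟙 Z) :
    𝒳 Z :=
  h.of_retract ⟨biprod.lift a b, biprod.desc a' b', by simpa using e⟩ (h.directSum _ _ hX hY)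

/-- Sources, targets and cokernels are additive in the arrow, so each turns `biprod.total` into a
decomposition of an identity; no component of the biproduct has to be computed. -/
lemma IsResolving.monoIn_biprod (h : IsResolving 𝒳) {f g : Arrow (ModuleCat.{v} R)}
    (hf : monoIn 𝒳 f) (hg : monoIn 𝒳 g) : monoIn 𝒳 (f ⊞ g) := by
  obtain ⟨h1, h2, h3, h4⟩ := hf
  obtain ⟨k1, k2, k3, k4⟩ := hg
  have e : (biprod.fst ≫ biprod.inl + biprod.snd ≫ biprod.inr : f ⊞ g ⟶ f ⊞ g) = 𝟙 _ :=
    biprod.total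
  have el := congrArg (fun t : f ⊞ g ⟶ f ⊞ g => CommaMorphism.left t) e
  have er := congrArg (fun t : f ⊞ g ⟶ f ⊞ g => CommaMorphism.right t) e
  have ec := congrArg cokMap e
  rw [cokMap_add, cokMap_comp, cokMap_comp, cokMap_id] at ec
  refine ⟨⟨fun {W} x y hxy => ?_⟩, h.prop_of_biprod_total h2 k2 el, h.prop_of_biprod_total h3 k3 er,
    h.prop_of_biprod_total h4 k4 ec⟩
  have key : ∀ (q : Arrow (ModuleCat.{v} R)) (_ : Mono q.hom) (m : f ⊞ g ⟶ q),
      x ≫ m.left = y ≫ m.left := fun q _ m => by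
    rw [← cancel_mono q.hom, Category.assoc, Category.assoc, Arrow.w m, reassoc_of% hxy]
  have el' : (biprod.fst : f ⊞ g ⟶ f).left ≫ (biprod.inl : f ⟶ f ⊞ g).left +
      (biprod.snd : f ⊞ g ⟶ g).left ≫ (biprod.inr : g ⟶ f ⊞ g).left = 𝟙 _ := el
  rw [← Category.comp_id x, ← Category.comp_id y, ← el', Preadditive.comp_add,
    Preadditive.comp_add, reassoc_of% key f h1 biprod.fst, reassoc_of% key g k1 biprod.snd]

/-- The cokernels of a short exact sequence of monomorphisms form a left exact sequence. -/
lemma exact_cokMap {K T F : Arrow (ModuleCat.{v} R)} [Mono F.hom] {k : K ⟶ T}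
    {p : T ⟶ F} (hl : k.left ≫ p.left = 0) (hr : k.right ≫ p.right = 0)
    (hc : cokMap k ≫ cokMap p = 0)
    (el : (ShortComplex.mk _ _ hl).ShortExact) (er : (ShortComplex.mk _ _ hr).ShortExact) :
    (ShortComplex.mk _ _ hc).Exact ∧ Mono (cokMap k) := by
  have surj : ∀ (f : Arrow (ModuleCat.{v} R)) (x : (cokernel f.hom : ModuleCat.{v} R)),
      ∃ y, cokernel.π f.hom y = x :=
    fun f => (ModuleCat.epi_iff_surjective (cokernel.π f.hom)).1 inferInstance
  have zer : ∀ (f : Arrow (ModuleCat.{v} R)) (x : f.right), cokernel.π f.hom x = 0 →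
      ∃ y, f.hom y = x :=
    fun f => (ShortComplex.moduleCat_exact_iff _).1 (ShortComplex.exact_cokernel f.hom)
  have nat : ∀ (f g : Arrow (ModuleCat.{v} R)) (m : f ⟶ g) (x : f.right),
      cokMap m (cokernel.π f.hom x) = cokernel.π g.hom (m.right x) := fun f g m x =>
    congrArg (fun t => ModuleCat.Hom.hom t x) (π_cokMap m)
  have sq : ∀ (f g : Arrow (ModuleCat.{v} R)) (m : f ⟶ g) (x : f.left),
      g.hom (m.left x) = m.right (f.hom x) := fun f g m x =>
    congrArg (fun t => ModuleCat.Hom.hom t x) (Arrow.w m)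
  have van : ∀ (f : Arrow (ModuleCat.{v} R)) (x : f.left), cokernel.π f.hom (f.hom x) = 0 :=
    fun f x => congrArg (fun t => ModuleCat.Hom.hom t x) (cokernel.condition f.hom)
  have exl : ∀ x : T.left, p.left x = 0 → ∃ y, k.left y = x :=
    (ShortComplex.moduleCat_exact_iff _).1 el.exact
  have exr : ∀ x : T.right, p.right x = 0 → ∃ y, k.right y = x :=
    (ShortComplex.moduleCat_exact_iff _).1 er.exact
  have surjl : ∀ x : F.left, ∃ y, p.left y = x := (ModuleCat.epi_iff_surjective _).1 el.epi_g
  have injF : Function.Injective F.hom := (ModuleCat.mono_iff_injective _).1 inferInstance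
  have injk : Function.Injective k.right := (ModuleCat.mono_iff_injective _).1 er.mono_f
  have zr : ∀ x, p.right (k.right x) = 0 := fun x =>
    congrArg (fun t => ModuleCat.Hom.hom t x) hr
  constructor
  · rw [ShortComplex.moduleCat_exact_iff]
    intro y hy
    obtain ⟨t, rfl⟩ := surj T y
    change cokMap p (cokernel.π T.hom t) = 0 at hy
    rw [nat] at hy
    obtain ⟨a, ha⟩ := zer F _ hy
    obtain ⟨a', rfl⟩ := surjl a
    rw [sq] at ha
    -- Subtracting an element of the image of `T.hom` keeps the class of `t` and moves it into the
    -- kernel of `p.right`.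
    obtain ⟨b, hb⟩ := exr (t - T.hom a') (by rw [map_sub, ha, sub_self])
    refine ⟨cokernel.π K.hom b, ?_⟩
    change cokMap k (cokernel.π K.hom b) = _
    rw [nat, hb, map_sub, van, sub_zero]
  · rw [ModuleCat.mono_iff_injective, injective_iff_map_eq_zero]
    intro x hx
    obtain ⟨b, rfl⟩ := surj K x
    rw [nat] at hx
    obtain ⟨a, ha⟩ := zer T _ hx
    -- This is where the snake lemma enters: the kernel of `F.hom` vanishes, so no connecting map
    -- obstructs injectivity.
    have h1 : p.left a = 0 := injF (by rw [sq, ha, zr, map_zero])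
    obtain ⟨a', rfl⟩ := exl a h1
    rw [sq] at ha
    rw [← injk ha, van]

end Resolving

/-! ### Admissible epimorphisms and the three types of projective objects -/

section Projectives

variable {R : Type u} [Ring R] {𝒳 : ObjectProperty (ModuleCat.{v} R)}

lemma IsAdmissibleEpi.sections {Y Z : (monoIn 𝒳).FullSubcategory} {p : Y ⟶ Z}
    (hp : IsAdmissibleEpi (scwExact 𝒳) p) :
    (∃ s : Z.obj.left ⟶ Y.obj.left, s ≫ p.hom.left = 𝟙 _) ∧
    (∃ s : Z.obj.right ⟶ Y.obj.right, s ≫ p.hom.right = 𝟙 _) ∧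
    ∃ s : cokernel Z.obj.hom ⟶ cokernel Y.obj.hom, s ≫ cokMap p.hom = 𝟙 _ := by
  obtain ⟨X, i, h, -, ⟨s₁⟩, ⟨s₂⟩, ⟨s₃⟩⟩ := hp
  exact ⟨⟨s₁.s, s₁.s_g⟩, ⟨s₂.s, s₂.s_g⟩, ⟨s₃.s, s₃.s_g⟩⟩

/-- The kernel is formed on sources and targets; `exact_cokMap` identifies its cokernel as the
kernel of `cokMap p.hom`, so all three of its modules lie in `𝒳`. -/
lemma IsResolving.isAdmissibleEpi (h : IsResolving 𝒳) {Y Z : (monoIn 𝒳).FullSubcategory}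
    (p : Y ⟶ Z) (hl : ∃ s : Z.obj.left ⟶ Y.obj.left, s ≫ p.hom.left = 𝟙 _)
    (hr : ∃ s : Z.obj.right ⟶ Y.obj.right, s ≫ p.hom.right = 𝟙 _)
    (hc : ∃ s : cokernel Z.obj.hom ⟶ cokernel Y.obj.hom, s ≫ cokMap p.hom = 𝟙 _) :
    IsAdmissibleEpi (scwExact 𝒳) p := by
  obtain ⟨s₁, h₁⟩ := hl
  obtain ⟨s₂, h₂⟩ := hr
  obtain ⟨s₃, h₃⟩ := hc
  have : Epi p.hom.left := epi_of_epi_fac h₁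
  have : Epi p.hom.right := epi_of_epi_fac h₂
  have : Epi (cokMap p.hom) := epi_of_epi_fac h₃
  have : Mono Y.obj.hom := Y.property.1
  have : Mono Z.obj.hom := Z.property.1
  let K : Arrow (ModuleCat.{v} R) := Arrow.mk (kernel.map p.hom.left p.hom.right Y.obj.hom Z.obj.hom
    p.hom.w)
  let k : K ⟶ Y.obj := Arrow.homMk (kernel.ι p.hom.left) (kernel.ι p.hom.right) (by simp [K])
  have kp : k ≫ p.hom = 0 := Arrow.hom_ext _ _ (kernel.condition _) (kernel.condition _)
  have el : (ShortComplex.mk k.left p.hom.left (kernel.condition _)).ShortExact :=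
    { exact := ShortComplex.exact_kernel p.hom.left
      mono_f := (inferInstance : Mono (kernel.ι p.hom.left)) }
  have er : (ShortComplex.mk k.right p.hom.right (kernel.condition _)).ShortExact :=
    { exact := ShortComplex.exact_kernel p.hom.right
      mono_f := (inferInstance : Mono (kernel.ι p.hom.right)) }
  have hkp : cokMap k ≫ cokMap p.hom = 0 := by rw [← cokMap_comp, kp, cokMap_zero]
  obtain ⟨ec, hm⟩ := exact_cokMap _ _ hkp el er
  have hK : monoIn 𝒳 K :=
    ⟨(inferInstance : Mono (kernel.map _ _ _ _ p.hom.w)), h.kernel _ el Y.property.2.1 Z.property.2.1,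
      h.kernel _ er Y.property.2.2.1 Z.property.2.2.1,
      h.kernel _ ⟨ec⟩ Y.property.2.2.2 Z.property.2.2.2⟩
  refine ⟨⟨K, hK⟩, ObjectProperty.homMk k, by ext1; exact kp, ⟨el, er⟩, ⟨?_⟩, ⟨?_⟩, ⟨?_⟩⟩
  · exact ShortComplex.Splitting.ofExactOfSection _ el.exact s₁ h₁ el.mono_f
  · exact ShortComplex.Splitting.ofExactOfSection _ er.exact s₂ h₂ er.mono_f
  · exact ShortComplex.Splitting.ofExactOfSection _ ec s₃ h₃ hm

lemma isProjectiveObj_mk_id {X : ModuleCat.{v} R} (hX : monoIn 𝒳 (Arrow.mk (𝟙 X))) :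
    IsProjectiveObj (scwExact 𝒳) ⟨Arrow.mk (𝟙 X), hX⟩ := fun Y Z p hp m => by
  obtain ⟨⟨s, hs⟩, -, -⟩ := hp.sections
  have : Mono Z.obj.hom := Z.property.1
  have hw : m.hom.left ≫ Z.obj.hom = m.hom.right := (Arrow.w m.hom).trans (Category.id_comp _)
  refine ⟨ObjectProperty.homMk (Arrow.homMk (f := Arrow.mk (𝟙 X)) (g := Y.obj)
    (m.hom.left ≫ s) (m.hom.left ≫ s ≫ Y.obj.hom) (by simp)), ?_⟩
  ext1
  apply arrow_hom_ext
  change (m.hom.left ≫ s ≫ Y.obj.hom) ≫ p.hom.right = m.hom.right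
  rw [← hw, Category.assoc, Category.assoc, ← Arrow.w p.hom, reassoc_of% hs]

lemma isProjectiveObj_mk_zero {X : ModuleCat.{v} R}
    (hX : monoIn 𝒳 (Arrow.mk (0 : (0 : ModuleCat.{v} R) ⟶ X))) :
    IsProjectiveObj (scwExact 𝒳) ⟨Arrow.mk (0 : (0 : ModuleCat.{v} R) ⟶ X), hX⟩ :=
  fun Y Z p hp m => by
  obtain ⟨-, ⟨s, hs⟩, -⟩ := hp.sections
  have : Mono Z.obj.hom := Z.property.1
  refine ⟨ObjectProperty.homMk (Arrow.homMk (f := Arrow.mk (0 : (0 : ModuleCat.{v} R) ⟶ X))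
    (g := Y.obj) 0 (m.hom.right ≫ s) (by simp)), ?_⟩
  ext1
  apply arrow_hom_ext
  change (m.hom.right ≫ s) ≫ p.hom.right = m.hom.right
  rw [Category.assoc, hs, Category.comp_id]

/-- Lift the map of cokernels along `t` and then to an arrow morphism `n`. The error `n ≫ p - m`
dies on cokernels, so it comes from a map `q` to the source of `Z`, which `s` lifts to the source of
`Y`; subtracting this correction gives the lift. -/
lemma isProjectiveObj_of_projective_right (g : (monoIn 𝒳).FullSubcategory)
    [Projective g.obj.right] : IsProjectiveObj (scwExact 𝒳) g := fun Y Z p hp m => by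
  obtain ⟨⟨s, hs⟩, -, ⟨t, ht⟩⟩ := hp.sections
  have : Mono Z.obj.hom := Z.property.1
  have : Mono Y.obj.hom := Y.property.1
  obtain ⟨n, hn⟩ := exists_cokMap_eq (f := Y.obj) (cokMap m.hom ≫ t)
  obtain ⟨q, hq⟩ := exists_right_eq_of_cokMap_eq_zero (m := n ≫ p.hom - m.hom)
    (by rw [cokMap_sub, cokMap_comp, hn, Category.assoc, ht, Category.comp_id, sub_self])
  refine ⟨ObjectProperty.homMk (n - arrowHomOfRight (q ≫ s)), ?_⟩
  ext1
  apply arrow_hom_ext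
  change (n - arrowHomOfRight (q ≫ s)).right ≫ p.hom.right = m.hom.right
  rw [arrow_sub_right, arrowHomOfRight_right, Preadditive.sub_comp, Category.assoc, Category.assoc,
    ← Arrow.w p.hom, reassoc_of% hs, hq, arrow_sub_right, Arrow.comp_right, sub_sub_cancel]

lemma IsResolving.zero (h : IsResolving 𝒳) : 𝒳 (0 : ModuleCat.{v} R) :=
  h.of_iso _ _ ⟨(ModuleCat.isZero_of_subsingleton (ModuleCat.of R PUnit)).iso (isZero_zero _)⟩
    (h.of_projective (ModuleCat.of R PUnit) inferInstance inferInstance)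

lemma IsResolving.monoIn_mk_id (h : IsResolving 𝒳) {X : ModuleCat.{v} R} (hX : 𝒳 X) :
    monoIn 𝒳 (Arrow.mk (𝟙 X)) :=
  ⟨(inferInstance : Mono (𝟙 X)), hX, hX,
    h.of_iso _ _ ⟨(isZero_zero _).iso (isZero_cokernel_of_epi (𝟙 X))⟩ h.zero⟩

lemma IsResolving.monoIn_mk_zero (h : IsResolving 𝒳) {X : ModuleCat.{v} R} (hX : 𝒳 X) :
    monoIn 𝒳 (Arrow.mk (0 : (0 : ModuleCat.{v} R) ⟶ X)) :=
  ⟨mono_zero_from_zero X, h.zero, hX, h.of_iso _ _ ⟨cokernelZeroIsoTarget.symm⟩ hX⟩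

/-- The cokernel of the kernel of an epimorphism. -/
lemma nonempty_cokernel_kernel_ι_iso {P X : ModuleCat.{v} R} (π : P ⟶ X) [Epi π] :
    Nonempty (cokernel (kernel.ι π) ≅ X) :=
  ⟨(cokernelIsCokernel (kernel.ι π)).coconePointUniqueUpToIso
    (Abelian.epiIsCokernelOfKernel (KernelFork.ofι _ (kernel.condition π)) (kernelIsKernel π))⟩

lemma IsResolving.monoIn_mk_kernel_ι (h : IsResolving 𝒳) {P X : ModuleCat.{v} R} (π : P ⟶ X)
    [Epi π] (hP : 𝒳 P) (hX : 𝒳 X) : monoIn 𝒳 (Arrow.mk (kernel.ι π)) := by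
  obtain ⟨i⟩ := nonempty_cokernel_kernel_ι_iso π
  exact ⟨(inferInstance : Mono (kernel.ι π)),
    h.kernel (ShortComplex.mk _ _ (kernel.condition π)) ⟨ShortComplex.exact_kernel π⟩ hP hX, hP,
    h.of_iso _ _ ⟨i.symm⟩ hX⟩

end Projectives

/-! ### Enough projectives and the classification -/

section EnoughProjectives

variable {R : Type v} [Ring R] {𝒳 : ObjectProperty (ModuleCat.{v} R)}

lemma IsResolving.prop_of_projective (h : IsResolving 𝒳) (P : ModuleCat.{v} R)
    [Module.Finite R P] [Projective P] : 𝒳 P :=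
  h.of_projective P inferInstance ((IsProjective.iff_projective P).2 ‹_›)

/-- The ring now lives in the universe of its modules, so that `Fin n → R` is an object of the
category. -/
lemma exists_epi_of_finite (M : ModuleCat.{v} R) [Module.Finite R M] :
    ∃ (P : ModuleCat.{v} R) (π : P ⟶ M), Module.Finite R P ∧ Projective P ∧ Epi π := by
  obtain ⟨n, φ, hφ⟩ := Module.Finite.exists_fin' R M
  refine ⟨ModuleCat.of R (Fin n → R), ModuleCat.ofHom φ, ?_, ?_, ?_⟩
  · change Module.Finite R (Fin n → R); infer_instance
  · exact (IsProjective.iff_projective (Fin n → R)).1 inferInstance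
  · exact (ModuleCat.epi_iff_surjective _).2 hφ

/-- The source of an essential epimorphism onto a finitely generated module is finitely
generated. -/
lemma IsProjectiveCover.finite {P M : ModuleCat.{v} R} {π : P ⟶ M} (hπ : IsProjectiveCover π)
    [Module.Finite R M] : Module.Finite R P := by
  obtain ⟨F, ρ, hF, _, hρ⟩ := exists_epi_of_finite M
  have := hπ.epi
  have hg := hπ.essential F (Projective.factorThru ρ π)
    (by rw [Projective.factorThru_comp]; exact hρ)
  exact Module.Finite.of_surjective (Projective.factorThru ρ π).hom
    ((ModuleCat.epi_iff_surjective _).1 hg)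

/-- Every object is covered by the sum of an identity, a morphism from zero, and a monomorphism
with projective target. -/
lemma IsResolving.exists_admissibleEpi (h : IsResolving 𝒳) (Z : (monoIn 𝒳).FullSubcategory) :
    ∃ (g : Arrow (ModuleCat.{v} R)) (_ : monoIn 𝒳 g) (_ : Projective g.right)
      (hT : monoIn 𝒳 (Arrow.mk (𝟙 Z.obj.left) ⊞
        (Arrow.mk (0 : (0 : ModuleCat.{v} R) ⟶ Z.obj.right) ⊞ g)))
      (p : (⟨_, hT⟩ : (monoIn 𝒳).FullSubcategory) ⟶ Z), IsAdmissibleEpi (scwExact 𝒳) p := by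
  obtain ⟨hm, hl, hr, hc⟩ := Z.property
  have := h.finite _ hc
  obtain ⟨P, π, _, hP, _⟩ := exists_epi_of_finite (cokernel Z.obj.hom)
  have : Projective (Arrow.mk (kernel.ι π)).right := hP
  obtain ⟨i⟩ := nonempty_cokernel_kernel_ι_iso π
  obtain ⟨m, hm'⟩ := exists_cokMap_eq (g := Arrow.mk (kernel.ι π)) (f := Z.obj) i.hom
  have hg := h.monoIn_mk_kernel_ι π (h.prop_of_projective P) hc
  let a : Arrow.mk (𝟙 Z.obj.left) ⟶ Z.obj := Arrow.homMk (𝟙 Z.obj.left) Z.obj.hom (by simp)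
  let b : Arrow.mk (0 : (0 : ModuleCat.{v} R) ⟶ Z.obj.right) ⟶ Z.obj :=
    Arrow.homMk 0 (𝟙 Z.obj.right) (by simp)
  let p := biprod.desc a (biprod.desc b m)
  let ia : Arrow.mk (𝟙 Z.obj.left) ⟶ Arrow.mk (𝟙 Z.obj.left) ⊞
    (Arrow.mk (0 : (0 : ModuleCat.{v} R) ⟶ Z.obj.right) ⊞ Arrow.mk (kernel.ι π)) := biprod.inl
  let ib : Arrow.mk (0 : (0 : ModuleCat.{v} R) ⟶ Z.obj.right) ⟶ Arrow.mk (𝟙 Z.obj.left) ⊞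
    (Arrow.mk (0 : (0 : ModuleCat.{v} R) ⟶ Z.obj.right) ⊞ Arrow.mk (kernel.ι π)) :=
    biprod.inl ≫ biprod.inr
  let im : Arrow.mk (kernel.ι π) ⟶ Arrow.mk (𝟙 Z.obj.left) ⊞
    (Arrow.mk (0 : (0 : ModuleCat.{v} R) ⟶ Z.obj.right) ⊞ Arrow.mk (kernel.ι π)) :=
    biprod.inr ≫ biprod.inr
  -- The inclusions `ia`, `ib`, `im` provide the sections on sources, targets and cokernels
  -- respectively.
  refine ⟨_, hg, hP, h.monoIn_biprod (h.monoIn_mk_id hl) (h.monoIn_biprod (h.monoIn_mk_zero hr) hg),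
    ObjectProperty.homMk p, h.isAdmissibleEpi _ ⟨ia.left, ?_⟩ ⟨ib.right, ?_⟩ ⟨i.inv ≫ cokMap im, ?_⟩⟩
  · have e : ia ≫ p = a := biprod.inl_desc _ _
    exact congrArg (fun t => CommaMorphism.left t) e
  · have e : ib ≫ p = b := by simp [ib, p]
    exact congrArg (fun t => CommaMorphism.right t) e
  · have e : im ≫ p = m := by simp [im, p]
    have e' := congrArg cokMap e
    rw [cokMap_comp, hm'] at e'
    rw [Category.assoc]
    exact (congrArg (i.inv ≫ ·) e').trans i.inv_hom_id

lemma isProjectiveObj_biprod {f g : Arrow (ModuleCat.{v} R)} {hf : monoIn 𝒳 f} {hg : monoIn 𝒳 g}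
    (pf : IsProjectiveObj (scwExact 𝒳) ⟨f, hf⟩) (pg : IsProjectiveObj (scwExact 𝒳) ⟨g, hg⟩)
    (hfg : monoIn 𝒳 (f ⊞ g)) : IsProjectiveObj (scwExact 𝒳) ⟨f ⊞ g, hfg⟩ :=
  pf.of_sum (X := ⟨f, hf⟩) (Y := ⟨g, hg⟩) (a := ObjectProperty.homMk biprod.fst)
    (a' := ObjectProperty.homMk biprod.inl) (b := ObjectProperty.homMk biprod.snd)
    (b' := ObjectProperty.homMk biprod.inr) pg (by ext1; exact biprod.total)

theorem IsResolving.hasEnoughProjectives (h : IsResolving 𝒳) :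
    HasEnoughProjectives (scwExact 𝒳) := fun Z => by
  obtain ⟨g, hg, hP, hT, p, hp⟩ := h.exists_admissibleEpi Z
  refine ⟨_, p, ?_, hp⟩
  have : Projective (⟨g, hg⟩ : (monoIn 𝒳).FullSubcategory).obj.right := hP
  exact isProjectiveObj_biprod
    (isProjectiveObj_mk_id (h.monoIn_mk_id Z.property.2.1))
    (isProjectiveObj_biprod (isProjectiveObj_mk_zero (h.monoIn_mk_zero Z.property.2.2.1))
      (isProjectiveObj_of_projective_right ⟨g, hg⟩)
      (h.monoIn_biprod (h.monoIn_mk_zero Z.property.2.2.1) hg)) hT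

/-- An arrow whose endomorphisms are units or nilpotent is a retract of one of the summands
whenever it is a retract of a direct sum. -/
lemma exists_retract_of_biprod {f g₁ g₂ : Arrow (ModuleCat.{v} R)}
    (hf : ∀ e : End f, IsUnit e ∨ IsNilpotent e) (r : Retract f (g₁ ⊞ g₂)) :
    Nonempty (Retract f g₁) ∨ Nonempty (Retract f g₂) := by
  have key : ∀ (g : Arrow (ModuleCat.{v} R)) (i : f ⟶ g) (j : g ⟶ f) (a : End f), a = i ≫ j →
      IsUnit a → Nonempty (Retract f g) := by
    rintro g i j a rfl h
    rw [isUnit_iff_isIso] at h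
    exact ⟨⟨i, j ≫ inv (i ≫ j), by rw [← Category.assoc, IsIso.hom_inv_id]⟩⟩
  let a : End f := (r.i ≫ biprod.fst) ≫ biprod.inl ≫ r.r
  let b : End f := (r.i ≫ biprod.snd) ≫ biprod.inr ≫ r.r
  have e : a + b = 1 := by
    have h1 : r.i ≫ (biprod.fst ≫ biprod.inl + biprod.snd ≫ biprod.inr) ≫ r.r = 𝟙 f := by
      rw [biprod.total, Category.id_comp, r.retract]
    refine Eq.trans ?_ h1
    rw [Preadditive.add_comp, Preadditive.comp_add]
    simp only [a, b, Category.assoc]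
  exact (isUnit_or_isUnit_of_add_eq_one hf e).imp (key _ _ _ a rfl) (key _ _ _ b rfl)

/-- A projective object with Fitting's dichotomy on endomorphisms is an isomorphism, or has zero
source, or has projective target. -/
lemma IsResolving.trichotomy (h : IsResolving 𝒳) (Z : (monoIn 𝒳).FullSubcategory)
    (hZ : IsProjectiveObj (scwExact 𝒳) Z) (hE : ∀ e : End Z.obj, IsUnit e ∨ IsNilpotent e) :
    IsIso Z.obj.hom ∨ IsZero Z.obj.left ∨ Projective Z.obj.right := by
  obtain ⟨g, hg, hP, hT, p, hp⟩ := h.exists_admissibleEpi Z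
  -- Projectivity splits the cover, making `Z` a retract of the threefold sum.
  obtain ⟨s, hs⟩ := hZ p hp (𝟙 Z)
  have r : Retract Z.obj _ := ⟨s.hom, p.hom, congrArg InducedCategory.Hom.hom hs⟩
  rcases exists_retract_of_biprod hE r with ⟨⟨r⟩⟩ | ⟨⟨r⟩⟩
  · left
    have : RetractArrow Z.obj.hom (𝟙 Z.obj.left) := r
    exact (MorphismProperty.isomorphisms _).of_retract this
      (inferInstance : IsIso (𝟙 Z.obj.left))
  · right
    rcases exists_retract_of_biprod hE r with ⟨⟨r⟩⟩ | ⟨⟨r⟩⟩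
    · left
      have r' : Retract Z.obj.left (0 : ModuleCat.{v} R) := r.map Arrow.leftFunc
      rw [IsZero.iff_id_eq_zero, ← r'.retract, (isZero_zero _).eq_of_tgt r'.i 0, zero_comp]
    · right
      have r' : Retract Z.obj.right g.right := r.map Arrow.rightFunc
      exact r'.projective

/-- The indecomposable projective objects of the monomorphism category. -/
theorem IsResolving.indecomposable_projective_iff [IsNoetherianRing R] [IsArtinianRing R]
    (h : IsResolving 𝒳) (f : Arrow (ModuleCat.{v} R)) :
    (∃ hf : monoIn 𝒳 f, IsIndecomposable (⟨f, hf⟩ : (monoIn 𝒳).FullSubcategory) ∧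
        IsProjectiveObj (scwExact 𝒳) ⟨f, hf⟩) ↔
      ∃ X : ModuleCat.{v} R, 𝒳 X ∧ IsIndecomposable X ∧
        (Nonempty (f ≅ Arrow.mk (𝟙 X)) ∨
          Nonempty (f ≅ Arrow.mk (0 : (0 : ModuleCat.{v} R) ⟶ X)) ∨
          ∃ (P : ModuleCat.{v} R) (π : P ⟶ X), IsProjectiveCover π ∧
            Nonempty (f ≅ Arrow.mk (kernel.ι π))) := by
  -- Stability under retracts makes the full subcategory idempotent complete, so indecomposability
  -- can be tested on idempotents of `f` as an arrow.
  have := h.isStableUnderRetracts_monoIn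
  simp only [isIndecomposable_iff, hasTrivialIdempotents_fullSubcategory_iff]
  constructor
  · rintro ⟨hf, hi, hp⟩
    obtain ⟨hm, hl, hr, hc⟩ := id hf
    have := h.finite _ hl
    have := h.finite _ hr
    have hE : ∀ e : End f, IsUnit e ∨ IsNilpotent e := hi.isUnit_or_isNilpotent
    have of_isIso : IsIso f.hom → HasTrivialIdempotents f.left ∧
        Nonempty (f ≅ Arrow.mk (𝟙 f.left)) := fun _ => by
      let i : f ≅ Arrow.mk (𝟙 f.left) := Arrow.isoMk (Iso.refl _) (asIso f.hom).symm (by simp)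
      exact ⟨(hasTrivialIdempotents_mk_id_iff _).1 (hi.of_iso i), ⟨i⟩⟩
    -- Isomorphisms are separated first: their cokernel is zero, so the third type could not be read
    -- off from it.
    by_cases hiso : IsIso f.hom
    · exact ⟨f.left, hl, (of_isIso hiso).1, Or.inl (of_isIso hiso).2⟩
    · rcases h.trichotomy ⟨f, hf⟩ hp hE with h1 | h1 | h1
      · exact absurd h1 hiso
      · let i : f ≅ Arrow.mk (0 : (0 : ModuleCat.{v} R) ⟶ f.right) :=
          Arrow.isoMk (h1.iso (isZero_zero _)) (Iso.refl _) (h1.eq_of_src _ _)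
        exact ⟨f.right, hr, (hasTrivialIdempotents_mk_zero_iff _).1 (hi.of_iso i),
          Or.inr (Or.inl ⟨i⟩)⟩
      · have : Projective f.right := h1
        exact ⟨cokernel f.hom, hc, hasTrivialIdempotents_coker hE hiso, Or.inr (Or.inr
          ⟨f.right, cokernel.π f.hom, ⟨h1, inferInstance, epi_of_epi_comp_cokernel_π hE hiso⟩,
            nonempty_arrow_iso_kernel_ι f⟩)⟩
  · rintro ⟨X, hX, hi, hf⟩
    have transfer : ∀ (g : Arrow (ModuleCat.{v} R)) (hg : monoIn 𝒳 g), HasTrivialIdempotents g →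
        IsProjectiveObj (scwExact 𝒳) ⟨g, hg⟩ → Nonempty (f ≅ g) →
        ∃ hf : monoIn 𝒳 f, HasTrivialIdempotents f ∧ IsProjectiveObj (scwExact 𝒳) ⟨f, hf⟩ := by
      rintro g hg ht hp ⟨i⟩
      have hf := h.monoIn_of_retract i.retract hg
      exact ⟨hf, ht.of_iso i.symm, hp.of_iso
        (ObjectProperty.isoMk (X := ⟨g, hg⟩) (Y := ⟨f, hf⟩) (monoIn 𝒳) i.symm)⟩
    rcases hf with hf | hf | ⟨P, π, hπ, hf⟩
    · exact transfer _ (h.monoIn_mk_id hX) ((hasTrivialIdempotents_mk_id_iff X).2 hi)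
        (isProjectiveObj_mk_id _) hf
    · exact transfer _ (h.monoIn_mk_zero hX) ((hasTrivialIdempotents_mk_zero_iff X).2 hi)
        (isProjectiveObj_mk_zero _) hf
    · have := hπ.epi
      have hP := hπ.projective
      have := h.finite _ hX
      have := hπ.finite
      have hg := h.monoIn_mk_kernel_ι π (h.prop_of_projective P) hX
      have : Projective (⟨Arrow.mk (kernel.ι π), hg⟩ : (monoIn 𝒳).FullSubcategory).obj.right := hP
      exact transfer _ hg (hi.mk_kernel_ι π hπ.essential)
        (isProjectiveObj_of_projective_right _) hf

end EnoughProjectives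

end MonoCat

theorem proposition3p10 {k : Type u} [CommRing k] [IsArtinianRing k]
    {Λ : Type v} [Ring Λ] [Algebra k Λ] [Module.Finite k Λ]
    (𝒳 : ObjectProperty (ModuleCat.{v} Λᵐᵒᵖ))
    (hres : MonoCat.IsResolving 𝒳) (hcf : MonoCat.IsContravariantlyFinite 𝒳) :
    (∀ f : Arrow (ModuleCat.{v} Λᵐᵒᵖ),
      (∃ hf : MonoCat.monoIn 𝒳 f,
        MonoCat.IsIndecomposable (⟨f, hf⟩ : (MonoCat.monoIn 𝒳).FullSubcategory) ∧
        MonoCat.IsProjectiveObj (MonoCat.scwExact 𝒳) ⟨f, hf⟩) ↔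
      ∃ X : ModuleCat.{v} Λᵐᵒᵖ, 𝒳 X ∧ MonoCat.IsIndecomposable X ∧
        (Nonempty (f ≅ Arrow.mk (𝟙 X)) ∨
          Nonempty (f ≅ Arrow.mk (0 : (0 : ModuleCat.{v} Λᵐᵒᵖ) ⟶ X)) ∨
          ∃ (P : ModuleCat.{v} Λᵐᵒᵖ) (π : P ⟶ X), MonoCat.IsProjectiveCover π ∧
            Nonempty (f ≅ Arrow.mk (kernel.ι π)))) ∧
    MonoCat.HasEnoughProjectives (MonoCat.scwExact 𝒳) := by
  -- Finiteness over the artinian ring `k` gives both chain conditions on `Λᵐᵒᵖ`, hence finite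
  -- length of the modules in `𝒳`, as Fitting's lemma requires.
  have : Module.Finite k Λᵐᵒᵖ := Module.Finite.equiv (MulOpposite.opLinearEquiv k)
  have : IsArtinianRing Λᵐᵒᵖ := IsArtinianRing.of_finite k Λᵐᵒᵖ
  have : IsNoetherianRing Λᵐᵒᵖ := IsNoetherianRing.of_finite k Λᵐᵒᵖ
  exact ⟨hres.indecomposable_projective_iff, hres.hasEnoughProjectives⟩
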